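/- For complex $d\times d$ positive definite matrices $A,B$, let real powers $A^r$ be defined by the functional calculus, let $A\,\#\,B=A^{1/2}(A^{-1/2}BA^{-1/2})^{1/2}A^{1/2}$ be the geometric mean, and let $\delta_\infty(A,B)=\max_{\lambda}|\log\lambda|$, where $\lambda$ runs over the (positive) eigenvalues of $AB^{-1}$. Let $-1<p<1$, $p\neq 0$, and let $D$ be a positive definite $d\times d$ matrix. (a) A positive definite matrix $G$ satisfies $$D\big((D+G)^p-D^p\big)D=G\big((D+G)^p-G^p\big)G$$ if and only if $G=D$. (b) For positive definite $G$ define $$\Phi_D(G)=\Big(D\big((D+G)^p-D^p\big)D\Big)\,\#\,\Big((D+G)^p-G^p\Big)^{-1}\quad\text{if } 0<p<1,$$ $$\Phi_D(G)=\Big(D\big(D^p-(D+G)^p\big)D\Big)\,\#\,\Big(G^p-(D+G)^p\Big)^{-1}\quad\text{if } -1<p<0.$$ Both arguments of $\#$ are positive definite, so $\Phi_D(G)$ is well defined and positive definite, and with $\beta=\dfrac{p}{2^{p+1}-2}$ we have $\beta<1$ and $$\delta_\infty(\Phi_D(G),D)\le\beta\,\delta_\infty(G,D)$$ for every positive definite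 $G$. -/

import Mathlib

open scoped MatrixOrder ComplexOrder

noncomputable section

/-- The geometric mean `A # B = A^(1/2) (A^(-1/2) B A^(-1/2))^(1/2) A^(1/2)` of two positive
definite complex matrices. Real powers of a positive definite matrix are given by the functional
calculus. -/
def geomMean {n : Type*} [Fintype n] [DecidableEq n] (A B : Matrix n n ℂ) : Matrix n n ℂ :=
  A ^ (1 / 2 : ℝ) * (A ^ (-(1 / 2) : ℝ) * B * A ^ (-(1 / 2) : ℝ)) ^ (1 / 2 : ℝ) * A ^ (1 / 2 : ℝ)

/-- The metric `δ∞(A, B) = ‖log Eig(A B⁻¹)‖_∞` on positive definite matrices: the largest modulus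
of the logarithms of the eigenvalues of `A B⁻¹` (these eigenvalues are positive reals when `A` and
`B` are positive definite; the supremum is over a finite set, and is `0` for matrices of size 0). -/
def deltaInf {n : Type*} [Fintype n] [DecidableEq n] (A B : Matrix n n ℂ) : ℝ :=
  sSup ((fun z : ℂ => ‖Complex.log z‖) '' spectrum ℂ (A * B⁻¹))

/-- First argument of the geometric mean defining `Φ_D(G)`:
`D((D+G)^p - D^p)D` for `p > 0` and `D(D^p - (D+G)^p)D` for `p < 0`. -/
def phiLeft {n : Type*} [Fintype n] [DecidableEq n] (p : ℝ) (D G : Matrix n n ℂ) :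
    Matrix n n ℂ :=
  if 0 < p then D * ((D + G) ^ p - D ^ p) * D else D * (D ^ p - (D + G) ^ p) * D

/-- Second argument of the geometric mean defining `Φ_D(G)`:
`((D+G)^p - G^p)⁻¹` for `p > 0` and `(G^p - (D+G)^p)⁻¹` for `p < 0`. -/
def phiRight {n : Type*} [Fintype n] [DecidableEq n] (p : ℝ) (D G : Matrix n n ℂ) :
    Matrix n n ℂ :=
  if 0 < p then ((D + G) ^ p - G ^ p)⁻¹ else (G ^ p - (D + G) ^ p)⁻¹

/-- The map `G ↦ Φ_D(G)`. -/
def phiMap {n : Type*} [Fintype n] [DecidableEq n] (p : ℝ) (D G : Matrix n n ℂ) :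
    Matrix n n ℂ :=
  geomMean (phiLeft p D G) (phiRight p D G)

end

/-! Put `S = D + G`, `l = exp (deltaInf G D)`, and let `X`, `Y` be the increments of the `p`-th
power from `D` and from `G` to `S`, signed to be positive. From `G ≤ l • D` follow `S ≤ (1 + l) • D`
and `(1 + l) • G ≤ l • S`; monotonicity (antitonicity for `p < 0`) of the power compares `X` and `Y`
with multiples of `S ^ p`. The sharp scalar bound `abs_one_add_rpow_sub_one_le` then gives `X ≤ l ^
(2β) • Y`, and symmetrically with `D`, `G` exchanged (`powIncr_le_powIncr`). `D` is the geometric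
mean of `D * X * D` and `X⁻¹`, so replacing `X⁻¹` by `Y⁻¹` moves the mean by a factor at most `l ^
β` (`geomMean_le`, `le_geomMean`). This is the contraction. The equation in (a) makes `G` a fixed
point of `phiMap`, and `β < 1` forces `deltaInf G D = 0`. -/

/-! ### Scalar inequalities. -/

theorem sinh_div_self_mono {x y : ℝ} (hx : 0 < x) (hxy : x ≤ y) :
    y / Real.sinh y ≤ x / Real.sinh x := by
  have hy : 0 < y := hx.trans_le hxy
  have hconv : ConvexOn ℝ (Set.Ici 0) Real.sinh := by
    apply MonotoneOn.convexOn_of_deriv (convex_Ici 0) Real.continuous_sinh.continuousOn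
      Real.differentiable_sinh.differentiableOn
    rw [Real.deriv_sinh]
    intro a ha c hc hac
    rw [interior_Ici] at ha hc
    exact Real.cosh_le_cosh.2 (by rwa [abs_of_pos ha, abs_of_pos hc])
  have h := hconv.2 (Set.mem_Ici.2 (le_refl (0 : ℝ))) (Set.mem_Ici.2 hy.le)
    (show 0 ≤ 1 - x / y by rw [sub_nonneg, div_le_one hy]; exact hxy)
    (show 0 ≤ x / y by positivity) (sub_add_cancel _ _)
  have e : x / y * y = x := by field_simp
  simp only [smul_eq_mul, mul_zero, Real.sinh_zero, zero_add, e] at h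
  rw [div_le_div_iff₀ (Real.sinh_pos_iff.2 hy) (Real.sinh_pos_iff.2 hx)]
  calc y * Real.sinh x ≤ y * (x / y * Real.sinh y) := by gcongr
    _ = x * Real.sinh y := by field_simp

theorem hasDerivAt_coth_div {t w : ℝ} (ht : 0 < t) (hw : 0 < w) :
    HasDerivAt (fun w => Real.cosh (t / w) / Real.sinh (t / w))
      (1 / t * (t / w / Real.sinh (t / w)) ^ 2) w := by
  have hs : Real.sinh (t / w) ≠ 0 := (Real.sinh_pos_iff.2 (by positivity)).ne'
  have hd : HasDerivAt (fun w => t / w) (-t / w ^ 2) w := by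
    convert! (hasDerivAt_const w t).div (hasDerivAt_id w) hw.ne' using 1
    simp
  convert! hd.cosh.div hd.sinh hs using 1
  have := Real.cosh_sq (t / w)
  field_simp
  linarith

/-- With `x = t / w`, the derivative is `(x / sinh x) ^ 2 / t`, which increases with `w`. -/
theorem convexOn_coth_div {t : ℝ} (ht : 0 < t) :
    ConvexOn ℝ (Set.Ioi 0) (fun w => Real.cosh (t / w) / Real.sinh (t / w)) := by
  apply MonotoneOn.convexOn_of_deriv (convex_Ioi 0)
  · exact fun w hw => (hasDerivAt_coth_div ht hw).continuousAt.continuousWithinAt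
  · rw [interior_Ioi]
    exact fun w hw => (hasDerivAt_coth_div ht hw).differentiableAt.differentiableWithinAt
  · rw [interior_Ioi]
    intro x hx y hy hxy
    rw [Set.mem_Ioi] at hx hy
    rw [(hasDerivAt_coth_div ht hx).deriv, (hasDerivAt_coth_div ht hy).deriv]
    have hpos : 0 < Real.sinh (t / x) := Real.sinh_pos_iff.2 (by positivity)
    gcongr 1 / t * ?_ ^ 2
    exact sinh_div_self_mono (by positivity) (by gcongr)

/-- A convex function lies below its chord inside the chord's interval, and above it outside. -/
theorem ConvexOn.exists_chord {f : ℝ → ℝ} (hf : ConvexOn ℝ (Set.Ioi 0) f) {x z : ℝ}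
    (hx : 0 < x) (hxz : x < z) :
    ∃ c₀ c₁ : ℝ, (∀ y, x ≤ y → y ≤ z → f y ≤ c₀ + c₁ * y) ∧
      (∀ y, 0 < y → y ≤ x → c₀ + c₁ * y ≤ f y) ∧ (∀ y, z ≤ y → c₀ + c₁ * y ≤ f y) := by
  have hz := hx.trans hxz
  have hd : 0 < z - x := sub_pos.2 hxz
  have key : ∀ y, f x - (f z - f x) / (z - x) * x + (f z - f x) / (z - x) * y
      = ((z - y) * f x + (y - x) * f z) / (z - x) := by
    intro y; field_simp; ring
  refine ⟨f x - (f z - f x) / (z - x) * x, (f z - f x) / (z - x), ?_, ?_, ?_⟩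
  · intro y h1 h2
    rw [key, le_div_iff₀ hd]
    rcases h1.eq_or_lt with rfl | h1
    · linarith
    rcases h2.eq_or_lt with rfl | h2
    · linarith
    linarith [hf.secant_mono_aux1 hx hz h1 h2]
  · intro y h0 h1
    rw [key, div_le_iff₀ hd]
    rcases h1.eq_or_lt with rfl | h1
    · linarith
    linarith [hf.secant_mono_aux1 h0 hz h1 hxz]
  · intro y h1
    rw [key, div_le_iff₀ hd]
    rcases h1.eq_or_lt with rfl | h1
    · linarith
    linarith [hf.secant_mono_aux1 hx (hz.trans h1) hxz h1]

/-- The difference of the two sides vanishes on `a` and, by `hlog`, on `log a`. Both may therefore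
be subtracted from `log (sinh (t * a))`, whose derivative is convex in `1 / a`. -/
theorem log_sinh_sub_le {p b t : ℝ} (hp : 0 < p) (hp1 : p ≤ 1) (hb : 1 ≤ b) (hbp : b + p ≤ 2)
    (hlog : Real.log (b + p) - Real.log b = p * Real.log 2) (ht : 0 < t) :
    Real.log (Real.sinh (t * (b + p))) - Real.log (Real.sinh (t * b))
      ≤ p * (Real.log (Real.sinh (t * 2)) - Real.log (Real.sinh (t * 1))) := by
  have hb0 : 0 < b := by linarith
  obtain ⟨c₀, c₁, hin, hlo, hhi⟩ := (convexOn_coth_div ht).exists_chord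
    (x := (b + p)⁻¹) (z := b⁻¹) (by positivity) (by gcongr; linarith)
  -- The chord in `1 / a` integrates to these two corrections, so `k` rises on `[1, b]`, falls on
  -- `[b, b + p]` and rises on `[b + p, 2]`.
  set k : ℝ → ℝ := fun a => Real.log (Real.sinh (t * a)) - t * c₀ * a - t * c₁ * Real.log a with hk
  have hder : ∀ a, 0 < a → HasDerivAt k
      (t * (Real.cosh (t / a⁻¹) / Real.sinh (t / a⁻¹) - (c₀ + c₁ * a⁻¹))) a := by
    intro a ha
    have hs : Real.sinh (t * a) ≠ 0 := (Real.sinh_pos_iff.2 (by positivity)).ne'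
    have h1 : HasDerivAt (fun a => t * a) t a := by simpa using (hasDerivAt_id a).const_mul t
    have h2 : HasDerivAt (fun a => t * c₀ * a) (t * c₀) a := by
      simpa using (hasDerivAt_id a).const_mul (t * c₀)
    have h3 := (Real.hasDerivAt_log ha.ne').const_mul (t * c₁)
    convert! ((h1.sinh.log hs).sub h2).sub h3 using 1
    rw [div_inv_eq_mul]
    ring
  have hcont : ∀ x y : ℝ, 1 ≤ x → ContinuousOn k (Set.Icc x y) := fun x y hx a ha =>
    (hder a (by linarith [ha.1])).continuousAt.continuousWithinAt
  have hdiff : ∀ x y : ℝ, 1 ≤ x → DifferentiableOn ℝ k (interior (Set.Icc x y)) :=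
    fun x y hx a ha => (hder a (by
      linarith [(interior_subset ha).1])).differentiableAt.differentiableWithinAt
  have m1 : k 1 ≤ k b := by
    refine monotoneOn_of_deriv_nonneg (convex_Icc 1 b) (hcont _ _ le_rfl) (hdiff _ _ le_rfl) ?_
      (Set.left_mem_Icc.2 hb) (Set.right_mem_Icc.2 hb) hb
    intro a ha
    have ha := interior_subset ha
    have ha0 : 0 < a := by linarith [ha.1]
    rw [(hder a ha0).deriv]
    exact mul_nonneg ht.le (sub_nonneg.2 (hhi _ (by gcongr; exact ha.2)))
  have m2 : k (b + p) ≤ k b := by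
    refine antitoneOn_of_deriv_nonpos (convex_Icc b (b + p)) (hcont _ _ hb) (hdiff _ _ hb) ?_
      (Set.left_mem_Icc.2 (by linarith)) (Set.right_mem_Icc.2 (by linarith)) (by linarith)
    intro a ha
    have ha := interior_subset ha
    have ha0 : 0 < a := by linarith [ha.1]
    rw [(hder a ha0).deriv]
    exact mul_nonpos_of_nonneg_of_nonpos ht.le
      (sub_nonpos.2 (hin _ (by gcongr; exact ha.2) (by gcongr; exact ha.1)))
  have m3 : k (b + p) ≤ k 2 := by
    refine monotoneOn_of_deriv_nonneg (convex_Icc (b + p) 2) (hcont _ _ (by linarith))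
      (hdiff _ _ (by linarith)) ?_ (Set.left_mem_Icc.2 hbp) (Set.right_mem_Icc.2 hbp) hbp
    intro a ha
    have ha := interior_subset ha
    have ha0 : 0 < a := by linarith [ha.1]
    rw [(hder a ha0).deriv]
    exact mul_nonneg ht.le (sub_nonneg.2 (hlo _ (by positivity) (by gcongr; exact ha.1)))
  -- `k 2 - k 1 ≥ k (b + p) - k b`, where the right side is nonpositive and `p ≤ 1`.
  have h : k (b + p) - k b ≤ p * (k 2 - k 1) := by nlinarith
  simp only [hk, Real.log_one] at h
  have e : t * c₁ * Real.log (b + p) - t * c₁ * Real.log b = t * c₁ * (p * Real.log 2) := by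
    rw [← hlog]; ring
  linarith

theorem two_rpow_lt {p : ℝ} (hp : 0 < p) (hp1 : p < 1) : (2 : ℝ) ^ p < 1 + p := by
  have := rpow_one_add_lt_one_add_mul_self (s := 1) (by norm_num) one_ne_zero hp hp1
  norm_num at this ⊢
  linarith

theorem lt_two_rpow {p : ℝ} (hp : 1 < p) : 1 + p < (2 : ℝ) ^ p := by
  have := one_add_mul_self_lt_rpow_one_add (s := 1) (by norm_num) one_ne_zero hp
  norm_num at this ⊢
  linarith

theorem contraction_const_pos {p : ℝ} (hp0 : p ≠ 0) :
    0 < p / ((2 : ℝ) ^ (p + 1) - 2) := by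
  have e : (2 : ℝ) ^ (p + 1) = 2 ^ p * 2 := by rw [Real.rpow_add_one two_ne_zero]
  rcases hp0.lt_or_gt with h | h
  · have := Real.rpow_lt_one_of_one_lt_of_neg (x := 2) (by norm_num) h
    exact div_pos_of_neg_of_neg h (by linarith)
  · have := Real.one_lt_rpow (x := 2) (by norm_num) h
    exact div_pos h (by linarith)

/-- Bernoulli's inequality for `(1 + 1) ^ (p + 1)`; its direction changes with the sign of `p`. -/
theorem contraction_const_lt_one {p : ℝ} (hp : -1 < p) (hp0 : p ≠ 0) :
    p / ((2 : ℝ) ^ (p + 1) - 2) < 1 := by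
  rcases hp0.lt_or_gt with h | h
  · have := two_rpow_lt (p := p + 1) (by linarith) (by linarith)
    rw [div_lt_one_of_neg (by linarith)]
    linarith
  · have := lt_two_rpow (p := p + 1) (by linarith)
    rw [div_lt_one (by linarith)]
    linarith

/-- The hyperbolic form of the sharp scalar estimate. -/
theorem sinh_le_two_cosh_rpow_mul_sinh {p t : ℝ} (hp : 0 < p) (hp1 : p < 1) (ht : 0 < t) :
    Real.sinh ((p / (2 ^ p - 1) + p) * t)
      ≤ (2 * Real.cosh t) ^ p * Real.sinh (p / (2 ^ p - 1) * t) := by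
  have h1 : (1 : ℝ) < 2 ^ p := Real.one_lt_rpow (by norm_num) hp
  -- This `b` solves `(b + p) / b = 2 ^ p`, which makes the estimate sharp as `t → 0`.
  set b := p / ((2 : ℝ) ^ p - 1) with hbdef
  have hd : (0 : ℝ) < 2 ^ p - 1 := by linarith
  have hb : 1 ≤ b := by
    rw [hbdef, one_le_div hd]; linarith [two_rpow_lt hp hp1]
  have hbp' : b + p = 2 ^ p * b := by rw [hbdef]; field_simp; ring
  have hbp : b + p ≤ 2 := by
    have h2 := two_rpow_lt (p := 1 - p) (by linarith) (by linarith)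
    rw [Real.rpow_sub two_pos, Real.rpow_one, div_lt_iff₀ (by positivity)] at h2
    rw [hbp', hbdef, ← mul_div_assoc, div_le_iff₀ hd]
    linarith
  have hb0 : 0 < b := by linarith
  have hlog : Real.log (b + p) - Real.log b = p * Real.log 2 := by
    rw [hbp', Real.log_mul (by positivity) hb0.ne', Real.log_rpow two_pos]; ring
  have key := log_sinh_sub_le hp hp1.le hb hbp hlog ht
  have hst : 0 < Real.sinh t := Real.sinh_pos_iff.2 ht
  have hsb : 0 < Real.sinh (b * t) := Real.sinh_pos_iff.2 (by positivity)
  have hse : 0 < Real.sinh ((b + p) * t) := Real.sinh_pos_iff.2 (by positivity)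
  have hc : 0 < 2 * Real.cosh t := by linarith [Real.cosh_pos t]
  have e2 : Real.log (Real.sinh (t * 2)) - Real.log (Real.sinh (t * 1))
      = Real.log (2 * Real.cosh t) := by
    rw [mul_one, mul_comm t 2, Real.sinh_two_mul,
      show 2 * Real.sinh t * Real.cosh t = 2 * Real.cosh t * Real.sinh t by ring,
      Real.log_mul hc.ne' hst.ne']
    ring
  rw [e2, mul_comm t, mul_comm t] at key
  rw [← Real.log_le_log_iff hse (by positivity), Real.log_mul (by positivity) hsb.ne',
    Real.log_rpow hc]
  linarith

/-- The sharp comparison of the increments of `x ↦ x ^ p`. -/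
theorem one_add_rpow_sub_one_le {p l : ℝ} (hp : 0 < p) (hp1 : p < 1) (hl : 1 ≤ l) :
    (1 + l) ^ p - 1 ≤ l ^ (p / ((2 : ℝ) ^ p - 1)) * ((1 + l) ^ p - l ^ p) := by
  rcases hl.eq_or_lt with rfl | hl
  · simp
  set b := p / ((2 : ℝ) ^ p - 1) with hb
  -- Factoring `exp t` out of `1 + l` turns the claim into the hyperbolic form.
  obtain ⟨t, ht, rfl⟩ : ∃ t, 0 < t ∧ l = Real.exp (2 * t) :=
    ⟨Real.log l / 2, by have := Real.log_pos hl; positivity, by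
      rw [mul_div_cancel₀ _ two_ne_zero, Real.exp_log (by linarith)]⟩
  have h := sinh_le_two_cosh_rpow_mul_sinh hp hp1 ht
  rw [← hb] at h
  have e1 : 1 + Real.exp (2 * t) = Real.exp t * (2 * Real.cosh t) := by
    rw [Real.cosh_eq, show 2 * t = t + t by ring, Real.exp_add, Real.exp_neg]
    field_simp
    ring
  rw [e1, Real.mul_rpow (Real.exp_pos t).le (by linarith [Real.cosh_pos t]), ← Real.exp_mul,
    ← Real.exp_mul, ← Real.exp_mul]
  set C := (2 * Real.cosh t) ^ p
  rw [Real.sinh_eq, Real.sinh_eq, Real.exp_neg, Real.exp_neg, add_mul, Real.exp_add,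
    mul_comm b t, mul_comm p t] at h
  rw [show 2 * t * b = t * b + t * b by ring, show 2 * t * p = t * p + t * p by ring,
    Real.exp_add, Real.exp_add]
  have hE := Real.exp_pos (t * b)
  have hP := Real.exp_pos (t * p)
  set E := Real.exp (t * b)
  set P := Real.exp (t * p)
  have h' := mul_le_mul_of_nonneg_left h (show 0 ≤ 2 * (E * P) by positivity)
  have l1 : 2 * (E * P) * ((E * P - (E * P)⁻¹) / 2) = E * E * (P * P) - 1 := by
    field_simp
  have l2 : 2 * (E * P) * (C * ((E - E⁻¹) / 2)) = C * P * (E * E) - C * P := by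
    field_simp
  rw [l1, l2] at h'
  linarith

/-! ### Loewner order and matrix powers. -/

section
variable {n : Type*} [Fintype n] [DecidableEq n] {A B C D G Z : Matrix n n ℂ}

theorem Matrix.rpow_le_rpow {p : ℝ} (hp : p ∈ Set.Icc 0 1) (h : A ≤ B) : A ^ p ≤ B ^ p := by
  let _ : CStarAlgebra (Matrix n n ℂ) := Matrix.instCStarAlgebra
  exact CFC.rpow_le_rpow hp h

theorem Matrix.rpow_neg_one_le_rpow_neg_one (hA : A.PosDef) (h : A ≤ B) :
    B ^ (-1 : ℝ) ≤ A ^ (-1 : ℝ) := by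
  let _ : CStarAlgebra (Matrix n n ℂ) := Matrix.instCStarAlgebra
  exact CStarAlgebra.rpow_neg_one_le_rpow_neg_one h hA.isStrictlyPositive

theorem Matrix.PosDef.rpow (hA : A.PosDef) (p : ℝ) : (A ^ p).PosDef :=
  Matrix.isStrictlyPositive_iff_posDef.1
    (IsUnit.isStrictlyPositive (hA.isUnit.cfcRpow p hA.posSemidef.nonneg) CFC.rpow_nonneg)

theorem Matrix.PosDef.rpow_neg_one (hA : A.PosDef) : A ^ (-1 : ℝ) = A⁻¹ := by
  refine (Matrix.inv_eq_left_inv ?_).symm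
  have := CFC.rpow_neg_mul_rpow 1 hA.isStrictlyPositive
  rwa [CFC.rpow_one A hA.posSemidef.nonneg] at this

theorem Matrix.PosDef.inv_le_inv (hA : A.PosDef) (hB : B.PosDef) (h : A ≤ B) : B⁻¹ ≤ A⁻¹ := by
  rw [← hA.rpow_neg_one, ← hB.rpow_neg_one]
  exact Matrix.rpow_neg_one_le_rpow_neg_one hA h

theorem Matrix.PosDef.rpow_le_rpow_of_neg {p : ℝ} (hp : p ∈ Set.Ico (-1) 0) (hA : A.PosDef)
    (h : A ≤ B) : B ^ p ≤ A ^ p := by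
  have hB : B.PosDef := by
    simpa using hA.add_posSemidef (Matrix.le_iff.1 h)
  have key := Matrix.rpow_neg_one_le_rpow_neg_one (hA.rpow (-p))
    (Matrix.rpow_le_rpow (p := -p) ⟨by linarith [hp.2], by linarith [hp.1]⟩ h)
  have hp0 : -p ≠ 0 := by linarith [hp.2]
  rwa [CFC.rpow_rpow B (-p) (-1) hp0 hB.isStrictlyPositive,
    CFC.rpow_rpow A (-p) (-1) hp0 hA.isStrictlyPositive, neg_mul_neg, mul_one] at key

theorem Matrix.PosDef.smul_rpow {c : ℝ} (hc : 0 < c) (hA : A.PosDef) (p : ℝ) :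
    (c • A) ^ p = c ^ p • A ^ p := by
  have h0 := hA.posSemidef.nonneg
  have hpos : ∀ x ∈ spectrum ℝ A, 0 < x := fun x hx => hA.isStrictlyPositive.spectrum_pos hx
  have e : c • A = cfc (fun x : ℝ => c * x) A := by
    rw [cfc_const_mul_id c A]
  have hc' : ContinuousOn (fun x : ℝ => x ^ p) (spectrum ℝ A) := fun x hx =>
    (Real.continuousAt_rpow_const x p (Or.inl (hpos x hx).ne')).continuousWithinAt
  rw [e, CFC.cfc_rpow (fun x hx => mul_pos hc (hpos x hx)), CFC.rpow_eq_cfc_real h0,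
    ← cfc_const_mul (c ^ p) _ A hc']
  exact cfc_congr fun x hx => Real.mul_rpow hc.le (hpos x hx).le

theorem Matrix.PosDef.mul_mul_self (hA : A.PosDef) (hB : B.PosDef) : (A * B * A).PosDef := by
  have := (Matrix.IsUnit.posDef_star_left_conjugate_iff hA.isUnit).2 hB
  rwa [Matrix.star_eq_conjTranspose, hA.1.eq] at this

theorem Matrix.real_smul_le_smul {c : ℝ} (hc : 0 ≤ c) (h : A ≤ B) : c • A ≤ c • B :=
  smul_le_smul_of_nonneg_left h hc

theorem Matrix.real_smul_le_smul_right {c d : ℝ} (h : c ≤ d) (hA : 0 ≤ A) : c • A ≤ d • A :=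
  smul_le_smul_of_nonneg_right h hA

end

section
variable {n : Type*} {A B : Matrix n n ℂ}

theorem Matrix.PosDef.real_smul {c : ℝ} (hc : 0 < c) (hA : A.PosDef) : (c • A).PosDef :=
  hA.smul hc

theorem Matrix.PosDef.of_le (hA : A.PosDef) (h : A ≤ B) : B.PosDef := by
  simpa using hA.add_posSemidef (Matrix.le_iff.1 h)

end

/-! ### Geometric mean and the metric. -/

section
variable {n : Type*} [Fintype n] [DecidableEq n] {A B C D G Z : Matrix n n ℂ}

theorem Matrix.real_smul_le_smul_iff {c : ℝ} (hc : 0 < c) : c • A ≤ c • B ↔ A ≤ B :=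
  smul_le_smul_iff_of_pos_left hc

theorem Matrix.PosDef.rpow_half_mul_rpow_neg_half (hA : A.PosDef) :
    A ^ (1 / 2 : ℝ) * A ^ (-(1 / 2) : ℝ) = 1 :=
  CFC.rpow_mul_rpow_neg _ hA.isStrictlyPositive

theorem Matrix.PosDef.rpow_neg_half_mul_rpow_half (hA : A.PosDef) :
    A ^ (-(1 / 2) : ℝ) * A ^ (1 / 2 : ℝ) = 1 :=
  CFC.rpow_neg_mul_rpow _ hA.isStrictlyPositive

theorem Matrix.PosDef.rpow_half_mul_self (hA : A.PosDef) :
    A ^ (1 / 2 : ℝ) * A ^ (1 / 2 : ℝ) = A := by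
  rw [← CFC.rpow_add hA.isUnit, add_halves, CFC.rpow_one A hA.posSemidef.nonneg]

theorem Matrix.PosDef.rpow_neg_half_mul_self (hA : A.PosDef) :
    A ^ (-(1 / 2) : ℝ) * A ^ (-(1 / 2) : ℝ) = A⁻¹ := by
  rw [← CFC.rpow_add hA.isUnit, ← hA.rpow_neg_one]
  norm_num

theorem Matrix.rpow_half_of_mul_self (hA : 0 ≤ A) : (A * A) ^ (1 / 2 : ℝ) = A := by
  let _ : CStarAlgebra (Matrix n n ℂ) := Matrix.instCStarAlgebra
  have := CFC.sqrt_mul_self A hA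
  rwa [CFC.sqrt_eq_rpow] at this

theorem Matrix.PosDef.geomMean (hA : A.PosDef) (hB : B.PosDef) : (_root_.geomMean A B).PosDef :=
  (hA.rpow _).mul_mul_self (((hA.rpow _).mul_mul_self hB).rpow _)

theorem rpow_half_conj (hA : A.PosDef) :
    A ^ (1 / 2 : ℝ) * (A ^ (-(1 / 2) : ℝ) * Z * A ^ (-(1 / 2) : ℝ)) * A ^ (1 / 2 : ℝ) = Z := by
  calc _ = (A ^ (1 / 2 : ℝ) * A ^ (-(1 / 2) : ℝ)) * Z * (A ^ (-(1 / 2) : ℝ) * A ^ (1 / 2 : ℝ)) := by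
        noncomm_ring
    _ = Z := by
        rw [hA.rpow_half_mul_rpow_neg_half, hA.rpow_neg_half_mul_rpow_half, one_mul, mul_one]

theorem conj_rpow_neg_half_mul_self (hA : A.PosDef) :
    (A ^ (-(1 / 2) : ℝ) * Z * A ^ (-(1 / 2) : ℝ)) * (A ^ (-(1 / 2) : ℝ) * Z * A ^ (-(1 / 2) : ℝ))
      = A ^ (-(1 / 2) : ℝ) * (Z * A⁻¹ * Z) * A ^ (-(1 / 2) : ℝ) := by
  rw [← hA.rpow_neg_half_mul_self]
  noncomm_ring

theorem rpow_half_conj_sq {k : ℝ} (hk : 0 < k) (hA : A.PosDef) (hZ : Z.PosDef) :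
    (A ^ (-(1 / 2) : ℝ) * (k ^ 2 • (Z * A⁻¹ * Z)) * A ^ (-(1 / 2) : ℝ)) ^ (1 / 2 : ℝ)
      = A ^ (-(1 / 2) : ℝ) * (k • Z) * A ^ (-(1 / 2) : ℝ) := by
  rw [← Matrix.rpow_half_of_mul_self
    ((hA.rpow (-(1 / 2))).mul_mul_self (hZ.real_smul hk)).posSemidef.nonneg,
    conj_rpow_neg_half_mul_self hA]
  simp only [smul_mul_assoc, mul_smul_comm, smul_smul, sq]

/-- `k • Z` is the mean of `A` and `k ^ 2 • (Z * A⁻¹ * Z)`, and the mean is monotone in its second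
argument because the square root is operator monotone. -/
theorem geomMean_le {k : ℝ} (hk : 0 < k) (hA : A.PosDef) (hZ : Z.PosDef)
    (h : C ≤ k ^ 2 • (Z * A⁻¹ * Z)) : geomMean A C ≤ k • Z := by
  have h1 := Matrix.rpow_le_rpow (p := 1 / 2) (by norm_num)
    (conjugate_le_conjugate_of_nonneg h (CFC.rpow_nonneg (a := A) (y := -(1 / 2))))
  rw [rpow_half_conj_sq hk hA hZ] at h1
  have h2 := conjugate_le_conjugate_of_nonneg h1 (CFC.rpow_nonneg (a := A) (y := 1 / 2))
  rwa [rpow_half_conj hA] at h2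

theorem le_geomMean {k : ℝ} (hk : 0 < k) (hA : A.PosDef) (hZ : Z.PosDef)
    (h : k ^ 2 • (Z * A⁻¹ * Z) ≤ C) : k • Z ≤ geomMean A C := by
  have h1 := Matrix.rpow_le_rpow (p := 1 / 2) (by norm_num)
    (conjugate_le_conjugate_of_nonneg h (CFC.rpow_nonneg (a := A) (y := -(1 / 2))))
  rw [rpow_half_conj_sq hk hA hZ] at h1
  have h2 := conjugate_le_conjugate_of_nonneg h1 (CFC.rpow_nonneg (a := A) (y := 1 / 2))
  rwa [rpow_half_conj hA] at h2

/-- The geometric mean solves the Riccati equation `Z * A⁻¹ * Z = C`. -/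
theorem geomMean_eq (hA : A.PosDef) (hZ : Z.PosDef) (h : Z * A⁻¹ * Z = C) : geomMean A C = Z := by
  apply le_antisymm
  · simpa using geomMean_le one_pos hA hZ (C := C) (by simp [h])
  · simpa using le_geomMean one_pos hA hZ (C := C) (by simp [h])

/-- Similarity by `D ^ (1 / 2)` replaces `G * D⁻¹` by a Hermitian matrix, so spectral bounds become
order bounds. -/
theorem spectrum_mul_inv (hD : D.PosDef) :
    spectrum ℂ (G * D⁻¹) = spectrum ℂ (D ^ (-(1 / 2) : ℝ) * G * D ^ (-(1 / 2) : ℝ)) := by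
  let u : (Matrix n n ℂ)ˣ := ⟨D ^ (1 / 2 : ℝ), D ^ (-(1 / 2) : ℝ),
    hD.rpow_half_mul_rpow_neg_half, hD.rpow_neg_half_mul_rpow_half⟩
  rw [← spectrum.units_conjugate (a := D ^ (-(1 / 2) : ℝ) * G * D ^ (-(1 / 2) : ℝ)) (u := u)]
  congr 1
  change _ = D ^ (1 / 2 : ℝ) * (D ^ (-(1 / 2) : ℝ) * G * D ^ (-(1 / 2) : ℝ)) * D ^ (-(1 / 2) : ℝ)
  calc G * D⁻¹ = 1 * G * (D ^ (-(1 / 2) : ℝ) * D ^ (-(1 / 2) : ℝ)) := by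
        rw [hD.rpow_neg_half_mul_self, one_mul]
    _ = _ := by rw [← hD.rpow_half_mul_rpow_neg_half]; noncomm_ring

theorem norm_log_ofReal {x : ℝ} (hx : 0 < x) : ‖Complex.log (x : ℂ)‖ = |Real.log x| := by
  rw [← Complex.ofReal_log hx.le, Complex.norm_real, Real.norm_eq_abs]

theorem algebraMap_rpow_conj (hD : D.PosDef) (c : ℝ) :
    D ^ (1 / 2 : ℝ) * algebraMap ℝ (Matrix n n ℂ) c * D ^ (1 / 2 : ℝ) = c • D := by
  rw [Algebra.algebraMap_eq_smul_one, mul_smul_comm, mul_one, smul_mul_assoc,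
    hD.rpow_half_mul_self]

theorem exp_neg_smul_le_iff (r : ℝ) : Real.exp (-r) • D ≤ G ↔ D ≤ Real.exp r • G := by
  rw [← Matrix.real_smul_le_smul_iff (Real.exp_pos r), smul_smul, ← Real.exp_add]
  simp

theorem mem_spectrum_bounds (hD : D.PosDef) (hG : G.PosDef) {x : ℝ}
    (hx : x ∈ spectrum ℝ (D ^ (-(1 / 2) : ℝ) * G * D ^ (-(1 / 2) : ℝ))) :
    0 < x ∧ |Real.log x| ≤ deltaInf G D := by
  have hM := (hD.rpow (-(1 / 2))).mul_mul_self hG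
  have hx0 : 0 < x := hM.isStrictlyPositive.spectrum_pos hx
  refine ⟨hx0, ?_⟩
  have hc : (x : ℂ) ∈ spectrum ℂ (G * D⁻¹) := by
    rw [spectrum_mul_inv hD]
    exact spectrum.algebraMap_mem ℂ hx
  rw [← norm_log_ofReal hx0]
  exact le_csSup ((Matrix.finite_spectrum (G * D⁻¹)).image _).bddAbove ⟨_, hc, rfl⟩

theorem le_exp_deltaInf_smul (hD : D.PosDef) (hG : G.PosDef) :
    G ≤ Real.exp (deltaInf G D) • D ∧ D ≤ Real.exp (deltaInf G D) • G := by
  have hM := (hD.rpow (-(1 / 2))).mul_mul_self hG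
  constructor
  · have h : D ^ (-(1 / 2) : ℝ) * G * D ^ (-(1 / 2) : ℝ)
        ≤ algebraMap ℝ _ (Real.exp (deltaInf G D)) := by
      refine le_algebraMap_of_spectrum_le (fun x hx => ?_) hM.1
      obtain ⟨h0, h1⟩ := mem_spectrum_bounds hD hG hx
      exact (Real.log_le_iff_le_exp h0).1 (abs_le.1 h1).2
    have := conjugate_le_conjugate_of_nonneg h (CFC.rpow_nonneg (a := D) (y := 1 / 2))
    rwa [rpow_half_conj hD, algebraMap_rpow_conj hD] at this
  · have h : algebraMap ℝ _ (Real.exp (-deltaInf G D))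
        ≤ D ^ (-(1 / 2) : ℝ) * G * D ^ (-(1 / 2) : ℝ) := by
      refine algebraMap_le_of_le_spectrum (fun x hx => ?_) hM.1
      obtain ⟨h0, h1⟩ := mem_spectrum_bounds hD hG hx
      exact (Real.le_log_iff_exp_le h0).1 (abs_le.1 h1).1
    have := conjugate_le_conjugate_of_nonneg h (CFC.rpow_nonneg (a := D) (y := 1 / 2))
    rwa [rpow_half_conj hD, algebraMap_rpow_conj hD, exp_neg_smul_le_iff] at this

theorem conj_smul_self (hD : D.PosDef) (c : ℝ) :
    D ^ (-(1 / 2) : ℝ) * (c • D) * D ^ (-(1 / 2) : ℝ) = algebraMap ℝ _ c := by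
  rw [mul_smul_comm, smul_mul_assoc, Algebra.algebraMap_eq_smul_one]
  congr 1
  calc _ = D ^ (-(1 / 2) : ℝ) * (D ^ (1 / 2 : ℝ) * D ^ (1 / 2 : ℝ)) * D ^ (-(1 / 2) : ℝ) := by
        rw [hD.rpow_half_mul_self]
    _ = (D ^ (-(1 / 2) : ℝ) * D ^ (1 / 2 : ℝ)) * (D ^ (1 / 2 : ℝ) * D ^ (-(1 / 2) : ℝ)) := by
        noncomm_ring
    _ = 1 := by
        rw [hD.rpow_half_mul_rpow_neg_half, hD.rpow_neg_half_mul_rpow_half, one_mul]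

theorem deltaInf_le {r : ℝ} (hr : 0 ≤ r) (hD : D.PosDef) (hG : G.PosDef)
    (h₁ : G ≤ Real.exp r • D) (h₂ : D ≤ Real.exp r • G) : deltaInf G D ≤ r := by
  have hM := (hD.rpow (-(1 / 2))).mul_mul_self hG
  have hR := CFC.rpow_nonneg (a := D) (y := -(1 / 2))
  -- `hr` covers size zero, where the supremum of the empty set is `0`.
  refine Real.sSup_le ?_ hr
  rintro _ ⟨z, hz, rfl⟩
  rw [spectrum_mul_inv hD, hM.1.spectrum_eq_image_range] at hz
  obtain ⟨x, ⟨i, hi⟩, rfl⟩ := hz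
  have hx : x ∈ spectrum ℝ (D ^ (-(1 / 2) : ℝ) * G * D ^ (-(1 / 2) : ℝ)) :=
    hi ▸ hM.1.eigenvalues_mem_spectrum_real i
  have hx0 : 0 < x := hM.isStrictlyPositive.spectrum_pos hx
  have h1 := conjugate_le_conjugate_of_nonneg h₁ hR
  have h2 := conjugate_le_conjugate_of_nonneg ((exp_neg_smul_le_iff r).2 h₂) hR
  rw [conj_smul_self hD] at h1 h2
  have b1 := (le_algebraMap_iff_spectrum_le (R := ℝ) hM.1).1 h1 x hx
  have b2 := (algebraMap_le_iff_le_spectrum (R := ℝ) hM.1).1 h2 x hx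
  change ‖Complex.log (x : ℂ)‖ ≤ r
  rw [norm_log_ofReal hx0, abs_le]
  exact ⟨(Real.le_log_iff_exp_le hx0).2 b2, (Real.log_le_iff_le_exp hx0).2 b1⟩

theorem deltaInf_nonneg (G D : Matrix n n ℂ) : 0 ≤ deltaInf G D :=
  Real.sSup_nonneg (by rintro _ ⟨z, -, rfl⟩; exact norm_nonneg _)

theorem eq_of_deltaInf_eq_zero (hD : D.PosDef) (hG : G.PosDef) (h : deltaInf G D = 0) : G = D := by
  have := le_exp_deltaInf_smul hD hG
  rw [h] at this
  exact le_antisymm (by simpa using this.1) (by simpa using this.2)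
end

/-! ### Increments of the power and the contraction. -/

/-- The comparison of increments of `x ↦ x ^ p`, for exponents of either sign. -/
theorem abs_one_add_rpow_sub_one_le {p l : ℝ} (hp : -1 < p) (hp1 : p < 1) (hp0 : p ≠ 0)
    (hl : 1 ≤ l) :
    |(1 + l) ^ p - 1| ≤ l ^ (p / ((2 : ℝ) ^ p - 1)) * |(1 + l) ^ p - l ^ p| := by
  have hl0 : 0 < l := by linarith
  rcases hp0.lt_or_gt with h | h
  · obtain ⟨q, rfl⟩ : ∃ q, p = -q := ⟨-p, by ring⟩
    have hq : 0 < q := by linarith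
    have key := one_add_rpow_sub_one_le hq (by linarith) hl
    have h2 : (1 : ℝ) < 2 ^ q := Real.one_lt_rpow (by norm_num) hq
    -- The extra `q` in the exponent absorbs the factor `l ^ q` left by clearing denominators,
    -- reducing to the positive case.
    have e : -q / ((2 : ℝ) ^ (-q) - 1) = q / (2 ^ q - 1) + q := by
      have : (2 : ℝ) ^ q - 1 ≠ 0 := by linarith
      rw [Real.rpow_neg two_pos.le, show ((2 : ℝ) ^ q)⁻¹ - 1 = -((2 ^ q - 1) / 2 ^ q) by
        field_simp; ring]
      field_simp
      ring
    rw [e, Real.rpow_add hl0, Real.rpow_neg (by linarith), Real.rpow_neg hl0.le]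
    have hu : 1 ≤ (1 + l) ^ q := Real.one_le_rpow (by linarith) hq.le
    have hu0 : 0 < (1 + l) ^ q := by linarith
    have hv0 : 0 < l ^ q := by positivity
    have hvu : l ^ q ≤ (1 + l) ^ q := by gcongr; linarith
    have e1 : ((1 + l) ^ q)⁻¹ - 1 = -(((1 + l) ^ q - 1) / (1 + l) ^ q) := by field_simp; ring
    have e2 : ((1 + l) ^ q)⁻¹ - (l ^ q)⁻¹ = -(((1 + l) ^ q - l ^ q) / ((1 + l) ^ q * l ^ q)) := by
      field_simp; ring
    rw [e1, e2, abs_neg, abs_neg, abs_of_nonneg (div_nonneg (by linarith) hu0.le),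
      abs_of_nonneg (div_nonneg (by linarith) (by positivity)), div_le_iff₀ hu0]
    refine key.trans_eq ?_
    field_simp
  · have hu : 1 ≤ (1 + l) ^ p := Real.one_le_rpow (by linarith) h.le
    have hvu : l ^ p ≤ (1 + l) ^ p := by gcongr; linarith
    rw [abs_of_nonneg (by linarith), abs_of_nonneg (by linarith)]
    exact one_add_rpow_sub_one_le h hp1 hl

theorem one_add_smul_le {n : Type*} {D G : Matrix n n ℂ} {l : ℝ} (h : G ≤ l • D) : (1 + l) • G ≤ l • (D + G) := by
  rw [add_smul, one_smul, smul_add]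
  gcongr

section
variable {n : Type*} [Fintype n] [DecidableEq n] {D G S : Matrix n n ℂ}

/-- The increment of the `p`-th power from `D` to `S`, with the sign that makes it positive
when `D < S`. -/
noncomputable def powIncr (p : ℝ) (D S : Matrix n n ℂ) : Matrix n n ℂ :=
  if 0 < p then S ^ p - D ^ p else D ^ p - S ^ p

theorem powIncr_le {p c : ℝ} (hp : -1 < p) (hp1 : p < 1) (hp0 : p ≠ 0) (hc : 1 ≤ c)
    (hS : S.PosDef) (hD : D.PosDef) (h : S ≤ c • D) :
    c ^ p • powIncr p D S ≤ |c ^ p - 1| • S ^ p := by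
  have hc0 : 0 < c := by linarith
  rcases hp0.lt_or_gt with h0 | h0
  · have := hS.rpow_le_rpow_of_neg ⟨hp.le, h0⟩ h
    rw [hD.smul_rpow hc0] at this
    rw [powIncr, if_neg h0.not_gt, abs_of_nonpos
      (by linarith [Real.rpow_le_one_of_one_le_of_nonpos hc h0.le]), smul_sub, neg_sub, sub_smul,
      one_smul]
    gcongr
  · have := Matrix.rpow_le_rpow ⟨h0.le, hp1.le⟩ h
    rw [hD.smul_rpow hc0] at this
    rw [powIncr, if_pos h0, abs_of_nonneg
      (by linarith [Real.one_le_rpow hc h0.le]), smul_sub, sub_smul, one_smul]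
    gcongr

theorem le_powIncr {p c d : ℝ} (hp : -1 < p) (hp1 : p < 1) (hp0 : p ≠ 0) (hd : 0 < d)
    (hdc : d ≤ c) (hS : S.PosDef) (hG : G.PosDef) (h : c • G ≤ d • S) :
    |c ^ p - d ^ p| • S ^ p ≤ c ^ p • powIncr p G S := by
  have hc0 : 0 < c := by linarith
  rcases hp0.lt_or_gt with h0 | h0
  · have := (hG.real_smul hc0).rpow_le_rpow_of_neg ⟨hp.le, h0⟩ h
    rw [hG.smul_rpow hc0, hS.smul_rpow hd] at this
    rw [powIncr, if_neg h0.not_gt, abs_of_nonpos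
      (by linarith [Real.rpow_le_rpow_of_nonpos hd hdc h0.le]), smul_sub, neg_sub, sub_smul]
    gcongr
  · have := Matrix.rpow_le_rpow ⟨h0.le, hp1.le⟩ h
    rw [hG.smul_rpow hc0, hS.smul_rpow hd] at this
    rw [powIncr, if_pos h0, abs_of_nonneg
      (by linarith [Real.rpow_le_rpow hd.le hdc h0.le]), smul_sub, sub_smul]
    gcongr

/-- The increment dominates a positive multiple of `S ^ p`, so strict monotonicity of the power is
not needed. -/
theorem powIncr_posDef {p l : ℝ} (hp : -1 < p) (hp1 : p < 1) (hp0 : p ≠ 0) (hl : 0 < l)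
    (hD : D.PosDef) (hG : G.PosDef) (h : G ≤ l • D) : (powIncr p G (D + G)).PosDef := by
  have hS := hD.add hG
  have key := le_powIncr (p := p) hp hp1 hp0 hl (c := 1 + l) (by linarith) hS hG (one_add_smul_le h)
  have hne : (1 + l) ^ p - l ^ p ≠ 0 := by
    rw [sub_ne_zero]
    intro h1
    have := (Real.rpow_left_inj (by linarith) hl.le hp0).1 h1
    linarith
  have hc : 0 < (1 + l) ^ p := by positivity
  have := (((hS.rpow p).real_smul (abs_pos.2 hne)).of_le key).real_smul (inv_pos.2 hc)
  rwa [smul_smul, inv_mul_cancel₀ hc.ne', one_smul] at this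

theorem powIncr_le_powIncr {p l : ℝ} (hp : -1 < p) (hp1 : p < 1) (hp0 : p ≠ 0) (hl : 1 ≤ l)
    (hD : D.PosDef) (hG : G.PosDef) (h : G ≤ l • D) :
    powIncr p D (D + G) ≤ l ^ (p / ((2 : ℝ) ^ p - 1)) • powIncr p G (D + G) := by
  have hS := hD.add hG
  have hl0 : 0 < l := by linarith
  have hc : 0 < (1 + l) ^ p := by positivity
  have h1 := powIncr_le (p := p) hp hp1 hp0 (c := 1 + l) (by linarith) hS hD
    (by rw [add_smul, one_smul]; gcongr)
  have h2 := le_powIncr (p := p) hp hp1 hp0 hl0 (c := 1 + l) (by linarith) hS hG (one_add_smul_le h)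
  have h3 := Matrix.real_smul_le_smul (c := l ^ (p / ((2 : ℝ) ^ p - 1))) (by positivity) h2
  have h4 := Matrix.real_smul_le_smul_right (abs_one_add_rpow_sub_one_le hp hp1 hp0 hl)
    (hS.rpow p).posSemidef.nonneg
  rw [mul_smul] at h4
  have h5 := (h1.trans h4).trans h3
  rwa [smul_comm, Matrix.real_smul_le_smul_iff hc] at h5

theorem phiLeft_eq (p : ℝ) (D G : Matrix n n ℂ) :
    phiLeft p D G = D * powIncr p D (D + G) * D := by
  unfold phiLeft powIncr; split_ifs <;> rfl

theorem phiRight_eq (p : ℝ) (D G : Matrix n n ℂ) :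
    phiRight p D G = (powIncr p G (D + G))⁻¹ := by
  unfold phiRight powIncr; split_ifs <;> rfl

/-- Exhibits `D` as the Riccati solution for `D * X * D` and `X⁻¹`. -/
theorem mul_inv_conj_mul (hD : D.PosDef) (X : Matrix n n ℂ) : D * (D * X * D)⁻¹ * D = X⁻¹ := by
  have h := (Matrix.isUnit_iff_isUnit_det D).1 hD.isUnit
  rw [Matrix.mul_inv_rev, Matrix.mul_inv_rev, ← mul_assoc, Matrix.mul_nonsing_inv _ h, one_mul,
    mul_assoc, Matrix.nonsing_inv_mul _ h, mul_one]

theorem inv_real_smul {c : ℝ} (hc : c ≠ 0) {X : Matrix n n ℂ} (hX : X.PosDef) :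
    (c • X)⁻¹ = c⁻¹ • X⁻¹ := by
  apply Matrix.inv_eq_left_inv
  rw [smul_mul_smul_comm, inv_mul_cancel₀ hc, one_smul,
    Matrix.nonsing_inv_mul _ ((Matrix.isUnit_iff_isUnit_det X).1 hX.isUnit)]

theorem inv_le_smul_inv {c : ℝ} (hc : 0 < c) {X Y : Matrix n n ℂ} (hX : X.PosDef) (hY : Y.PosDef)
    (h : X ≤ c • Y) : Y⁻¹ ≤ c • X⁻¹ := by
  have := hX.inv_le_inv (hY.real_smul hc) h
  rwa [inv_real_smul hc.ne' hY, ← Matrix.real_smul_le_smul_iff hc, smul_smul,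
    mul_inv_cancel₀ hc.ne', one_smul] at this

theorem phi_posDef {p : ℝ} (hp : -1 < p) (hp1 : p < 1) (hp0 : p ≠ 0) (hD : D.PosDef)
    (hG : G.PosDef) : (powIncr p D (D + G)).PosDef ∧ (powIncr p G (D + G)).PosDef := by
  obtain ⟨h1, h2⟩ := le_exp_deltaInf_smul hD hG
  refine ⟨?_, powIncr_posDef hp hp1 hp0 (Real.exp_pos _) hD hG h1⟩
  rw [add_comm]
  exact powIncr_posDef hp hp1 hp0 (Real.exp_pos _) hG hD h2

theorem phiMap_posDef {p : ℝ} (hp : -1 < p) (hp1 : p < 1) (hp0 : p ≠ 0) (hD : D.PosDef)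
    (hG : G.PosDef) :
    (phiLeft p D G).PosDef ∧ (phiRight p D G).PosDef ∧ (phiMap p D G).PosDef := by
  obtain ⟨h1, h2⟩ := phi_posDef hp hp1 hp0 hD hG
  have hL : (phiLeft p D G).PosDef := by rw [phiLeft_eq]; exact hD.mul_mul_self h1
  have hR : (phiRight p D G).PosDef := by rw [phiRight_eq]; exact h2.inv
  exact ⟨hL, hR, hL.geomMean hR⟩

theorem deltaInf_phiMap_le {p : ℝ} (hp : -1 < p) (hp1 : p < 1) (hp0 : p ≠ 0) (hD : D.PosDef)
    (hG : G.PosDef) :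
    deltaInf (phiMap p D G) D ≤ p / ((2 : ℝ) ^ (p + 1) - 2) * deltaInf G D := by
  obtain ⟨hX, hY⟩ := phi_posDef hp hp1 hp0 hD hG
  obtain ⟨hL, -, hP⟩ := phiMap_posDef hp hp1 hp0 hD hG
  obtain ⟨h1, h2⟩ := le_exp_deltaInf_smul hD hG
  have hd := deltaInf_nonneg G D
  have hl := Real.one_le_exp hd
  have hXY := powIncr_le_powIncr hp hp1 hp0 hl hD hG h1
  have hYX := powIncr_le_powIncr hp hp1 hp0 hl hG hD h2
  rw [add_comm G D] at hYX
  set r := p / ((2 : ℝ) ^ (p + 1) - 2) * deltaInf G D with hr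
  have hr0 : 0 ≤ r := mul_nonneg (contraction_const_pos hp0).le hd
  -- Since `2 ^ (p + 1) - 2 = 2 * (2 ^ p - 1)`, the scalar exponent is `2β`; the geometric mean
  -- halves it.
  have e : Real.exp (deltaInf G D) ^ (p / ((2 : ℝ) ^ p - 1)) = Real.exp r ^ 2 := by
    rw [← Real.exp_mul, ← Real.exp_nat_mul, hr, Real.rpow_add_one two_ne_zero,
      show (2 : ℝ) ^ p * 2 - 2 = (2 ^ p - 1) * 2 by ring, ← div_div]
    congr 1
    push_cast
    ring
  rw [e] at hXY hYX
  have hk := Real.exp_pos r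
  have hk2 : 0 < Real.exp r ^ 2 := by positivity
  have hinv : D * (phiLeft p D G)⁻¹ * D = (powIncr p D (D + G))⁻¹ := by
    rw [phiLeft_eq, mul_inv_conj_mul hD]
  refine deltaInf_le hr0 hD hP (geomMean_le hk hL hD ?_) ?_
  · rw [hinv, phiRight_eq]
    exact inv_le_smul_inv hk2 hX hY hXY
  · rw [← exp_neg_smul_le_iff]
    refine le_geomMean (Real.exp_pos _) hL hD ?_
    rw [hinv, phiRight_eq, Real.exp_neg, inv_pow, ← Matrix.real_smul_le_smul_iff hk2, smul_smul,
      mul_inv_cancel₀ hk2.ne', one_smul]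
    exact inv_le_smul_inv hk2 hY hX hYX

theorem phiMap_eq_self {p : ℝ} (hp : -1 < p) (hp1 : p < 1) (hp0 : p ≠ 0) (hD : D.PosDef)
    (hG : G.PosDef)
    (h : D * ((D + G) ^ p - D ^ p) * D = G * ((D + G) ^ p - G ^ p) * G) : phiMap p D G = G := by
  have h' : phiLeft p D G = G * powIncr p G (D + G) * G := by
    rw [phiLeft_eq]
    unfold powIncr
    split_ifs
    · exact h
    · rw [← neg_sub, ← neg_sub (_ ^ p) (G ^ p), mul_neg, neg_mul, h, mul_neg, neg_mul]
  refine geomMean_eq (phiMap_posDef hp hp1 hp0 hD hG).1 hG ?_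
  rw [h', phiRight_eq, mul_inv_conj_mul hG]

end

theorem proposition1 {n : Type*} [Fintype n] [DecidableEq n] (p : ℝ)
    (hp : -1 < p) (hp' : p < 1) (hp0 : p ≠ 0) (D : Matrix n n ℂ) (hD : D.PosDef) :
    (∀ G : Matrix n n ℂ, G.PosDef →
      (D * ((D + G) ^ p - D ^ p) * D = G * ((D + G) ^ p - G ^ p) * G ↔ G = D)) ∧
    p / ((2 : ℝ) ^ (p + 1) - 2) < 1 ∧
    (∀ G : Matrix n n ℂ, G.PosDef →
      (phiLeft p D G).PosDef ∧ (phiRight p D G).PosDef ∧ (phiMap p D G).PosDef ∧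
      deltaInf (phiMap p D G) D ≤ p / ((2 : ℝ) ^ (p + 1) - 2) * deltaInf G D) := by
  have hlt := contraction_const_lt_one hp hp0
  refine ⟨fun G hG => ⟨fun h => ?_, fun h => by rw [h]⟩, hlt, fun G hG => ?_⟩
  · have key := deltaInf_phiMap_le hp hp' hp0 hD hG
    rw [phiMap_eq_self hp hp' hp0 hD hG h] at key
    refine eq_of_deltaInf_eq_zero hD hG ?_
    -- `δ ≤ β * δ` with `β < 1` and `0 ≤ δ` gives `δ = 0`.
    nlinarith [deltaInf_nonneg G D]
  · obtain ⟨h1, h2, h3⟩ := phiMap_posDef hp hp' hp0 hD hG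
    exact ⟨h1, h2, h3, deltaInf_phiMap_le hp hp' hp0 hD hG⟩
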